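/- Let $\mathcal G=(\mathcal V,\mathcal E)$ be a simple undirected graph on $\mathcal V=\{1,\dots,n\}$, $n\ge 3$, with a fixed partition $\mathcal V=\mathcal V_A\sqcup\mathcal V_D$ into two non-empty sets (edges inside a part are allowed); write $\mathcal G(A,D)$ for the graph with this partition and $\mathcal K(A,D)$ for the complete graph on $\mathcal V$ with the same partition. For a configuration $p=(p_1,\dots,p_n)\in(\mathbb R^2)^n$ with pairwise distinct points put $b_{ij}=(p_j-p_i)/\|p_j-p_i\|$ and let $\mathcal R(\pi/2)$ be the counterclockwise rotation by $\pi/2$. The signed angle $\alpha_{ijk}\in[0,2\pi)$ is $\arccos(b_{ij}^\top b_{ik})$ if $b_{ik}^\top\mathcal R(\pi/2)b_{ij}\ge 0$ and $2\pi-\arccos(b_{ij}^\top b_{ik})$ otherwise; the ratio of distance is $\kappa_{ijk}=\|p_k-p_i\|/\|p_j-p_i\|$. The SA-RoD rigidity function $f_{\mathcal G(A,D)}(p)$ is the vector of all $\alpha_{uvw}$ with $u\in\mathcal V_A$ and all $\kappa_{uvw}$ with $u\in\mathcal V_D$, where $v<w$ run over the neighbours of $u$ in $\mathcal G$. The framework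 $(\mathcal G(A,D),p)$ is *SA-RoD rigid* if there is an open neighbourhood $U$ of $p$ with $$f_{\mathcal G(A,D)}^{-1}(f_{\mathcal G(A,D)}(p))\cap U=f_{\mathcal K(A,D)}^{-1}(f_{\mathcal K(A,D)}(p))\cap U .$$ A configuration is *generic* if its $2n$ coordinates satisfy no non-zero polynomial equation with integer coefficients; the rigidity function is then smooth near $p$. For generic $p$, the framework is *infinitesimally SA-RoD rigid* if every $\delta\in(\mathbb R^2)^n$ with $\frac{\partial f_{\mathcal G(A,D)}}{\partial p}(p)\,\delta=0$ is trivial, i.e. there are $\xi\in\mathbb R^2$ and $a,b\in\mathbb R$ with $\delta_i=\xi+a\,\mathcal R(\pi/2)p_i+b\,p_i$ for all $i$. **Theorem.** Let $p\in(\mathbb R^2)^n$ be a generic configuration. 1. If $(\mathcal G(A,D),p)$ is SA-RoD rigid, then $\mathcal G(A,D)$ is generically SA-RoD rigid: $(\mathcal G(A,D),q)$ is SA-RoD rigid for every generic configuration $q\in(\mathbb R^2)^n$. 2. If $(\mathcal G(A,D),p)$ is infinitesimally SA-RoD rigid, then $\mathcal G(A,D)$ is generically infinitesimally SA-RoD rigid: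 $(\mathcal G(A,D),q)$ is infinitesimally SA-RoD rigid for every generic configuration $q\in(\mathbb R^2)^n$. -/

import Mathlib

noncomputable section

namespace SARoD

/-- Points of the Euclidean plane. -/
abbrev Plane : Type := EuclideanSpace ℝ (Fin 2)

/-- Planar configurations of `n` nodes, `p = (p₁, …, pₙ) ∈ ℝ²ⁿ`. -/
abbrev Config (n : ℕ) : Type := Fin n → Plane

/-- A graph `G(A, D)` on the vertices `1, …, n` with a fixed bipartition of the vertex set into a
nonempty set `VA` of signed-angle vertices and a nonempty set `VD` of ratio-of-distance vertices.
Edges within a part are allowed: the bipartition only records the attribute of each vertex. -/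
structure BipGraph (n : ℕ) where
  graph : SimpleGraph (Fin n)
  VA : Set (Fin n)
  VD : Set (Fin n)
  cover : VA ∪ VD = Set.univ
  disj : VA ∩ VD = ∅
  nonemptyA : VA.Nonempty
  nonemptyD : VD.Nonempty

/-- The complete graph `K(A, D)` with the same bipartition as `G(A, D)`. -/
def BipGraph.complete {n : ℕ} (G : BipGraph n) : BipGraph n :=
  { G with graph := ⊤ }

/-- The signed-angle index set: `(u, v, w)` with `u ∈ VA`, `v, w` neighbours of `u`, `v < w`. -/
def BipGraph.TA {n : ℕ} (G : BipGraph n) : Set (Fin n × Fin n × Fin n) :=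
  {t | t.1 ∈ G.VA ∧ G.graph.Adj t.1 t.2.1 ∧ G.graph.Adj t.1 t.2.2 ∧ t.2.1 < t.2.2}

/-- The ratio-of-distance index set: `(u, v, w)` with `u ∈ VD`, `v, w` neighbours of `u`,
`v < w`. -/
def BipGraph.TD {n : ℕ} (G : BipGraph n) : Set (Fin n × Fin n × Fin n) :=
  {t | t.1 ∈ G.VD ∧ G.graph.Adj t.1 t.2.1 ∧ G.graph.Adj t.1 t.2.2 ∧ t.2.1 < t.2.2}

/-- The counterclockwise rotation of the plane by the angle `π / 2`. -/
def quarterTurn (x : Plane) : Plane := !₂[-(x 1), x 0]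

/-- The bearing `b_ij = (p_j - p_i) / ‖p_j - p_i‖`. -/
def bearing {n : ℕ} (p : Config n) (i j : Fin n) : Plane :=
  ‖p j - p i‖⁻¹ • (p j - p i)

open Classical in
/-- The signed angle `α_ijk ∈ [0, 2π)` at node `i`, from the direction of `j` counterclockwise to
the direction of `k`. -/
def signedAngle {n : ℕ} (p : Config n) (i j k : Fin n) : ℝ :=
  if 0 ≤ inner ℝ (bearing p i k) (quarterTurn (bearing p i j)) then
    Real.arccos (inner ℝ (bearing p i j) (bearing p i k))
  else
    2 * Real.pi - Real.arccos (inner ℝ (bearing p i j) (bearing p i k))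

/-- The ratio of distance `κ_ijk = ‖p_k - p_i‖ / ‖p_j - p_i‖` at node `i`. -/
def ratioOfDistance {n : ℕ} (p : Config n) (i j k : Fin n) : ℝ :=
  ‖p k - p i‖ / ‖p j - p i‖

/-- Different nodes are not collocated. The rigidity function lives on these configurations. -/
def NonCollocated {n : ℕ} (p : Config n) : Prop := Function.Injective p

/-- The SA-RoD rigidity function `f_G(A,D)`: the signed angles over `TA`, followed by the ratios of
distance over `TD`. -/
def rigidityFunction {n : ℕ} (G : BipGraph n) (p : Config n) : G.TA ⊕ G.TD → ℝ
  | Sum.inl t => signedAngle p t.1.1 t.1.2.1 t.1.2.2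
  | Sum.inr t => ratioOfDistance p t.1.1 t.1.2.1 t.1.2.2

/-- The fibre `f_G⁻¹(f_G(p))`, inside the non-collocated configurations. -/
def fibre {n : ℕ} (G : BipGraph n) (p : Config n) : Set (Config n) :=
  {q | NonCollocated q ∧ rigidityFunction G q = rigidityFunction G p}

/-- SA-RoD rigidity of the framework `(G(A, D), p)`. -/
def IsRigid {n : ℕ} (G : BipGraph n) (p : Config n) : Prop :=
  ∃ U : Set (Config n), IsOpen U ∧ p ∈ U ∧ fibre G p ∩ U = fibre G.complete p ∩ U

/-- The SA-RoD rigidity matrix `∂f_G/∂p`, the Jacobian matrix of the rigidity function in the `2n`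
coordinates of `p`. The rigidity function is smooth near each configuration without collinear
triples of nodes, in particular near each generic configuration. -/
def rigidityMatrix {n : ℕ} (G : BipGraph n) (p : Config n) :
    Matrix (G.TA ⊕ G.TD) (Fin n × Fin 2) ℝ :=
  Matrix.of fun t a =>
    fderiv ℝ (fun q : Config n => rigidityFunction G q t) p
      (Pi.single a.1 (EuclideanSpace.single a.2 (1 : ℝ)))

/-- Infinitesimal SA-RoD motions: velocities in the kernel of the rigidity matrix. -/
def IsInfinitesimalMotion {n : ℕ} (G : BipGraph n) (p δ : Config n) : Prop :=
  (rigidityMatrix G p).mulVec (fun a => δ a.1 a.2) = 0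

/-- Trivial infinitesimal motions: combinations of uniform translations, rotations and scalings. -/
def IsTrivialMotion {n : ℕ} (p δ : Config n) : Prop :=
  ∃ (ξ : Plane) (a b : ℝ), ∀ i, δ i = ξ + a • quarterTurn (p i) + b • p i

/-- Infinitesimal SA-RoD rigidity of the framework `(G(A, D), p)`. -/
def IsInfinitesimallyRigid {n : ℕ} (G : BipGraph n) (p : Config n) : Prop :=
  ∀ δ : Config n, IsInfinitesimalMotion G p δ → IsTrivialMotion p δ

/-- A configuration is generic if its `2n` coordinates satisfy no nonzero polynomial equation with
integer coefficients. -/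
def IsGeneric {n : ℕ} (p : Config n) : Prop :=
  AlgebraicIndependent ℤ (fun a : Fin n × Fin 2 => p a.1 a.2)

/-- `G(A, D)` is generically SA-RoD rigid. -/
def IsGenericallyRigid {n : ℕ} (G : BipGraph n) : Prop :=
  ∀ p : Config n, IsGeneric p → IsRigid G p

/-- `G(A, D)` is generically infinitesimally SA-RoD rigid. -/
def IsGenericallyInfinitesimallyRigid {n : ℕ} (G : BipGraph n) : Prop :=
  ∀ p : Config n, IsGeneric p → IsInfinitesimallyRigid G p

end SARoD

end

/-! Both kinds of rigidity are rank conditions on one matrix of integer polynomials, and such a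
matrix has the same linear dependences at every generic configuration.

Near a generic configuration a signed angle is a function, with nonzero derivative, of its cotangent
dot/cross, and a ratio of distance is such a function of its square (`exists_measurement_eq`).
Cotangent and square are quotients of integer polynomials, so up to nonzero factors the rows of the
rigidity matrix are polynomial vectors `grad G t`. Evaluation at a generic point is injective on
polynomials, hence independence and span membership carry over from `p` to `q`
(`IsGeneric.linearIndependent_iff`, `IsGeneric.mem_span`).

Fix a basis `s` of the rows of `G` at `p`. A row in its span satisfies a polynomial relation `c * u
= ∑ b i * w i` with `c ≠ 0`. The relation persists at all points near `p`, generic or not, so by a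
constant-rank argument the measurements in `s` determine that measurement locally. A row outside the
span gives one more coordinate of a submersion, so its measurement can move while those in `s` stay
fixed. Rigidity therefore means that every row of the complete graph lies in the span of `s`
(`isRigid_iff_mem_span`).

For infinitesimal rigidity, the kernels at `p` and `q` both have dimension `2n - |s|`. This is at
most 4 by the hypothesis at `p`, while the trivial motions at `q` already fill 4 dimensions of the
kernel there. -/

open Filter Topology

namespace SARoD

/-! ### Fibres of submersions -/

/-- A `C¹` function whose derivative vanishes on the kernel of the derivative of a `C¹` submersion
`G` near `p` is constant on the fibre of `G` through `p`, near `p`. -/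
theorem eventually_eq_of_ker_fderiv_le {E F : Type*} [NormedAddCommGroup E] [NormedSpace ℝ E]
    [FiniteDimensional ℝ E] [NormedAddCommGroup F] [NormedSpace ℝ F] [FiniteDimensional ℝ F]
    {G : E → F} {h : E → ℝ} {p : E} (hG : ContDiffAt ℝ 1 G p) (hh : ContDiffAt ℝ 1 h p)
    (hsurj : Function.Surjective (fderiv ℝ G p))
    (hker : ∀ᶠ x in 𝓝 p, ∀ v, fderiv ℝ G x v = 0 → fderiv ℝ h x v = 0) :
    ∀ᶠ x in 𝓝 p, G x = G p → h x = h p := by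
  have : CompleteSpace E := FiniteDimensional.complete ℝ E
  set L : E →L[ℝ] F := fderiv ℝ G p with hL
  obtain ⟨S₀, hS₀⟩ := L.toLinearMap.exists_rightInverse_of_surjective
    (LinearMap.range_eq_top.2 hsurj)
  set S : F →L[ℝ] E := LinearMap.toContinuousLinearMap S₀ with hS
  have hLS : ∀ y, L (S y) = y := fun y => LinearMap.congr_fun hS₀ y
  -- a local diffeomorphism straightening `G` to its derivative
  set Ψ : E → E := fun x => x + S (G x - L x) with hΨ
  have hLΨ : ∀ x, L (Ψ x) = G x := fun x => by simp [hΨ, hLS]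
  have hΨC : ContDiffAt ℝ 1 Ψ p :=
    contDiffAt_id.add (S.contDiff.contDiffAt.comp p (hG.sub L.contDiff.contDiffAt))
  have hΨd : HasFDerivAt Ψ ((ContinuousLinearEquiv.refl ℝ E : E ≃L[ℝ] E) : E →L[ℝ] E) p := by
    have h1 : HasFDerivAt G L p := (hG.differentiableAt one_ne_zero).hasFDerivAt
    have h2 := (hasFDerivAt_id p).add (S.hasFDerivAt.comp p (h1.sub L.hasFDerivAt))
    refine h2.congr_fderiv ?_
    ext v
    simp
  set inv : E → E := hΨC.localInverse hΨd one_ne_zero with hinv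
  have hinvp : inv (Ψ p) = p := hΨC.localInverse_apply_image hΨd one_ne_zero
  have hinvC : ContDiffAt ℝ 1 inv (Ψ p) := hΨC.to_localInverse hΨd one_ne_zero
  have hst := hΨC.hasStrictFDerivAt' hΨd one_ne_zero
  have hleft : ∀ᶠ x in 𝓝 p, inv (Ψ x) = x := hst.eventually_left_inverse
  have hright : ∀ᶠ y in 𝓝 (Ψ p), Ψ (inv y) = y := hst.eventually_right_inverse
  have hinvt : Tendsto inv (𝓝 (Ψ p)) (𝓝 p) := hst.localInverse_tendsto
  have hGd : ∀ᶠ x in 𝓝 p, DifferentiableAt ℝ G x :=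
    (hG.eventually (by simp)).mono fun x hx => hx.differentiableAt one_ne_zero
  have hhd : ∀ᶠ x in 𝓝 p, DifferentiableAt ℝ h x :=
    (hh.eventually (by simp)).mono fun x hx => hx.differentiableAt one_ne_zero
  have hid : ∀ᶠ y in 𝓝 (Ψ p), DifferentiableAt ℝ inv y :=
    (hinvC.eventually (by simp)).mono fun x hx => hx.differentiableAt one_ne_zero
  -- All local properties are gathered on one ball around `Ψ p`, whose convexity keeps whole
  -- segments inside it.
  have hall := (((hright.eventually_nhds.and hid).and (hinvt.eventually hGd)).and
    (hinvt.eventually hhd)).and (hinvt.eventually hker)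
  obtain ⟨ε, hε, hball⟩ := Metric.eventually_nhds_iff_ball.1 hall
  have hΨball : ∀ᶠ x in 𝓝 p, Ψ x ∈ Metric.ball (Ψ p) ε :=
    hΨC.continuousAt.eventually (Metric.ball_mem_nhds _ hε)
  filter_upwards [hleft, hΨball] with x hx hxb hGx
  -- In the coordinates `Ψ` the map `G` becomes linear, so the fibre through `p` becomes `Ψ p + ker
  -- L`, and `h` can be followed along a segment in it.
  set v := Ψ x - Ψ p with hv
  have hLv : L v = 0 := by rw [hv, map_sub, hLΨ, hLΨ, hGx, sub_self]
  have hmem : ∀ s ∈ Set.Icc (0 : ℝ) 1, Ψ p + s • v ∈ Metric.ball (Ψ p) ε := fun s hs =>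
    (convex_ball (Ψ p) ε).add_smul_sub_mem (Metric.mem_ball_self hε) hxb hs
  have hder : ∀ s ∈ Set.Icc (0 : ℝ) 1,
      HasDerivAt (fun s : ℝ => h (inv (Ψ p + s • v))) 0 s := by
    intro s hs
    obtain ⟨⟨⟨⟨hr, hi⟩, hg⟩, hh'⟩, hk⟩ := hball _ (hmem s hs)
    have hline : HasDerivAt (fun s : ℝ => Ψ p + s • v) v s := by
      simpa using ((hasDerivAt_id s).smul_const v).const_add (Ψ p)
    have hc : HasDerivAt (fun s : ℝ => inv (Ψ p + s • v))
        (fderiv ℝ inv (Ψ p + s • v) v) s := hi.hasFDerivAt.comp_hasDerivAt s hline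
    have hgc := hg.hasFDerivAt.comp_hasDerivAt s hc
    have hgc' : HasDerivAt (fun s : ℝ => G (inv (Ψ p + s • v))) (L v) s := by
      refine (L.hasFDerivAt.comp_hasDerivAt s hline).congr_of_eventuallyEq ?_
      filter_upwards [hline.continuousAt.eventually hr] with s' hs'
      simp only [Function.comp]
      rw [← hLΨ, hs']
    -- `G` has derivative `L v = 0` along the curve, so the velocity lies in the kernel to which
    -- `hker` applies.
    have hz : fderiv ℝ G (inv (Ψ p + s • v)) (fderiv ℝ inv (Ψ p + s • v) v) = 0 := by
      rw [← hLv]; exact hgc.unique hgc'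
    have := hh'.hasFDerivAt.comp_hasDerivAt s hc
    rwa [hk _ hz] at this
  have hconst := constant_of_has_deriv_right_zero (a := (0 : ℝ)) (b := 1)
    (f := fun s : ℝ => h (inv (Ψ p + s • v)))
    (fun s hs => (hder s hs).continuousAt.continuousWithinAt)
    (fun s hs => (hder s ⟨hs.1, hs.2.le⟩).hasDerivWithinAt) 1 (by simp)
  simpa [hv, hinvp, hx] using hconst

/-! ### Linear dependence of polynomial vectors at generic points -/

/-- A finite linearly independent family of coordinate vectors takes arbitrary values on a
suitable vector. -/
theorem exists_dotProduct_eq {ι σ : Type*} [Fintype ι] [Fintype σ] {a : ι → σ → ℝ}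
    (ha : LinearIndependent ℝ a) (y : ι → ℝ) : ∃ d : σ → ℝ, ∀ i, a i ⬝ᵥ d = y i := by
  have hrank : (Matrix.of a).rank = Fintype.card ι := LinearIndependent.rank_matrix ha
  have htop : LinearMap.range (Matrix.of a).mulVecLin = ⊤ := by
    apply Submodule.eq_top_of_finrank_eq
    rw [← Matrix.rank, hrank, Module.finrank_fintype_fun_eq_card]
  obtain ⟨d, hd⟩ := LinearMap.range_eq_top.1 htop y
  exact ⟨d, fun i => congrFun hd i⟩

/-- A vector of polynomials which depends on a linearly independent family at a point with
algebraically independent coordinates depends on it identically. -/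
theorem exists_mul_eq_sum {R ι σ : Type*} [CommRing R] [Finite σ] [Fintype ι] [Algebra R ℝ]
    [FaithfulSMul R ℝ] {w : ι → σ → R} {u : σ → R}
    (hw : LinearIndependent ℝ fun i => algebraMap R ℝ ∘ w i)
    (hu : algebraMap R ℝ ∘ u ∈ Submodule.span ℝ (Set.range fun i => algebraMap R ℝ ∘ w i)) :
    ∃ (c : R) (b : ι → R), c ≠ 0 ∧ ∀ a, c * u a = ∑ i, b i * w i a := by
  have hdep : ¬ LinearIndependent R (fun o : Option ι => o.elim u w) := by
    rw [← linearIndependent_algebraMap_comp_iff (S := ℝ), linearIndependent_option]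
    exact fun h => h.2 hu
  have hw' : LinearIndependent R w := linearIndependent_algebraMap_comp_iff.1 hw
  rw [Fintype.linearIndependent_iff] at hdep hw'
  push Not at hdep
  obtain ⟨g, hg, o, ho⟩ := hdep
  rw [Fintype.sum_option] at hg
  -- The coefficient of `u` cannot vanish: otherwise the relation would be a nontrivial one among
  -- the independent `w i`.
  refine ⟨g none, fun i => - g (some i), ?_, fun a => ?_⟩
  · intro h0
    simp only [Option.elim_none, h0, zero_smul, Option.elim_some, zero_add] at hg
    cases o with
    | none => exact ho h0
    | some i => exact ho (hw' (fun i => g (some i)) hg i)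
  · have := congrFun hg a
    simp only [Option.elim_none, Option.elim_some, Pi.add_apply, Pi.smul_apply, smul_eq_mul,
      Finset.sum_apply, Pi.zero_apply] at this
    simp only [neg_mul, Finset.sum_neg_distrib]
    linear_combination this

/-- Evaluation of an integer polynomial in the `2n` coordinates at a configuration. -/
noncomputable def evalAt {n : ℕ} (x : Config n) : MvPolynomial (Fin n × Fin 2) ℤ →ₐ[ℤ] ℝ :=
  MvPolynomial.aeval fun a => x a.1 a.2

@[simp]
theorem evalAt_X {n : ℕ} (x : Config n) (a : Fin n × Fin 2) :
    evalAt x (MvPolynomial.X a) = x a.1 a.2 := by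
  simp [evalAt]

theorem IsGeneric.evalAt_injective {n : ℕ} {p : Config n} (hp : IsGeneric p) :
    Function.Injective (evalAt p) := hp

theorem IsGeneric.evalAt_ne_zero {n : ℕ} {p : Config n} (hp : IsGeneric p)
    {P : MvPolynomial (Fin n × Fin 2) ℤ} (hP : P ≠ 0) : evalAt p P ≠ 0 :=
  (map_ne_zero_iff _ hp.evalAt_injective).2 hP

/-- Linear independence of polynomial vectors can be tested at a generic configuration. -/
theorem IsGeneric.linearIndependent_iff {n : ℕ} {p : Config n} (hp : IsGeneric p) {ι : Type*}
    {w : ι → Fin n × Fin 2 → MvPolynomial (Fin n × Fin 2) ℤ} :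
    LinearIndependent ℝ (fun i => evalAt p ∘ w i) ↔
      LinearIndependent (MvPolynomial (Fin n × Fin 2) ℤ) w := by
  let : Algebra (MvPolynomial (Fin n × Fin 2) ℤ) ℝ := (evalAt p).toRingHom.toAlgebra
  have : FaithfulSMul (MvPolynomial (Fin n × Fin 2) ℤ) ℝ :=
    (faithfulSMul_iff_algebraMap_injective _ _).2 hp.evalAt_injective
  exact linearIndependent_algebraMap_comp_iff

/-- Genericity makes evaluation at `p` a faithful algebra structure on `ℝ`. The resulting relation
holds between polynomials, so it can be evaluated at any other configuration. -/
theorem IsGeneric.exists_mul_eq_sum {n : ℕ} {p : Config n} (hp : IsGeneric p) {ι : Type*}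
    [Fintype ι] {w : ι → Fin n × Fin 2 → MvPolynomial (Fin n × Fin 2) ℤ}
    {u : Fin n × Fin 2 → MvPolynomial (Fin n × Fin 2) ℤ}
    (hw : LinearIndependent ℝ fun i => evalAt p ∘ w i)
    (hu : evalAt p ∘ u ∈ Submodule.span ℝ (Set.range fun i => evalAt p ∘ w i)) :
    ∃ (c : MvPolynomial (Fin n × Fin 2) ℤ) (b : ι → MvPolynomial (Fin n × Fin 2) ℤ),
      c ≠ 0 ∧ ∀ a, c * u a = ∑ i, b i * w i a := by
  let : Algebra (MvPolynomial (Fin n × Fin 2) ℤ) ℝ := (evalAt p).toRingHom.toAlgebra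
  have : FaithfulSMul (MvPolynomial (Fin n × Fin 2) ℤ) ℝ :=
    (faithfulSMul_iff_algebraMap_injective _ _).2 hp.evalAt_injective
  exact SARoD.exists_mul_eq_sum hw hu

/-! ### Derivatives of polynomials and their quotients -/

/-- The coordinate functionals on configurations. -/
noncomputable def coord {n : ℕ} (a : Fin n × Fin 2) : Config n →L[ℝ] ℝ :=
  (EuclideanSpace.proj a.2 : Plane →L[ℝ] ℝ).comp (ContinuousLinearMap.proj a.1)

@[simp]
theorem coord_apply {n : ℕ} (a : Fin n × Fin 2) (x : Config n) : coord a x = x a.1 a.2 := rfl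

/-- The functional on configurations with given coefficients in the coordinates. -/
noncomputable def form {n : ℕ} (c : Fin n × Fin 2 → ℝ) : Config n →L[ℝ] ℝ :=
  ∑ a, c a • coord a

theorem form_apply {n : ℕ} (c : Fin n × Fin 2 → ℝ) (δ : Config n) :
    form c δ = c ⬝ᵥ fun a => δ a.1 a.2 := by
  simp [form, dotProduct]

theorem form_basis {n : ℕ} (c : Fin n × Fin 2 → ℝ) (a : Fin n × Fin 2) :
    form c (Pi.single a.1 (EuclideanSpace.single a.2 (1 : ℝ))) = c a := by
  rw [form_apply, dotProduct, Finset.sum_eq_single a]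
  · simp
  · rintro ⟨i, k⟩ - hb
    obtain ⟨j, l⟩ := a
    by_cases hij : i = j
    · subst hij
      have : k ≠ l := fun h => hb (by rw [h])
      simp [this]
    · simp [hij]
  · simp

theorem contDiff_evalAt {n : ℕ} (P : MvPolynomial (Fin n × Fin 2) ℤ) :
    ContDiff ℝ 1 fun x : Config n => evalAt x P := by
  induction P using MvPolynomial.induction_on with
  | C a => simpa [evalAt] using contDiff_const
  | add P Q hP hQ => simpa using hP.add hQ
  | mul_X P a hP => simpa using hP.mul (coord a).contDiff

theorem hasFDerivAt_evalAt {n : ℕ} (P : MvPolynomial (Fin n × Fin 2) ℤ) (x : Config n) :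
    HasFDerivAt (fun x : Config n => evalAt x P)
      (form fun a => evalAt x (MvPolynomial.pderiv a P)) x := by
  induction P using MvPolynomial.induction_on with
  | C a =>
    simp only [evalAt, MvPolynomial.aeval_C, MvPolynomial.pderiv_C, map_zero]
    convert! hasFDerivAt_const (𝕜 := ℝ) _ x
    simp [form]
  | add P Q hP hQ =>
    simp only [map_add]
    refine (hP.add hQ).congr_fderiv ?_
    ext δ
    simp [form, add_smul, Finset.sum_add_distrib]
  | mul_X P b hP =>
    have h := hP.mul (coord b).hasFDerivAt
    simp only [map_mul, evalAt_X]
    refine h.congr_fderiv ?_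
    ext δ
    simp [form, MvPolynomial.pderiv_X, Pi.single_apply, add_mul,
      Finset.sum_add_distrib, Finset.mul_sum, apply_ite (evalAt x), mul_assoc]

/-- The numerator of the gradient of the quotient `P / Q`. -/
noncomputable def quotientGradient {n : ℕ} (P Q : MvPolynomial (Fin n × Fin 2) ℤ)
    (a : Fin n × Fin 2) : MvPolynomial (Fin n × Fin 2) ℤ :=
  Q * MvPolynomial.pderiv a P - P * MvPolynomial.pderiv a Q

theorem hasFDerivAt_quotient {n : ℕ} (P Q : MvPolynomial (Fin n × Fin 2) ℤ) {x : Config n}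
    (hQ : evalAt x Q ≠ 0) :
    HasFDerivAt (fun x : Config n => evalAt x P / evalAt x Q)
      ((evalAt x Q ^ 2)⁻¹ • form (evalAt x ∘ quotientGradient P Q)) x := by
  have h := (hasFDerivAt_evalAt P x).mul
    ((hasDerivAt_inv hQ).comp_hasFDerivAt x (hasFDerivAt_evalAt Q x))
  simp only [div_eq_mul_inv]
  refine h.congr_fderiv ?_
  ext δ
  simp only [form_apply, add_apply, smul_apply,
    smul_eq_mul, Function.comp_apply, dotProduct, quotientGradient, map_sub, map_mul, sub_mul,
    Finset.sum_sub_distrib, mul_assoc, ← Finset.mul_sum]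
  field_simp
  ring

theorem eventually_evalAt_ne_zero {n : ℕ} {Q : MvPolynomial (Fin n × Fin 2) ℤ} {p : Config n}
    (hQ : evalAt p Q ≠ 0) : ∀ᶠ x in 𝓝 p, evalAt x Q ≠ 0 :=
  (contDiff_evalAt Q).continuous.continuousAt.eventually_ne hQ

/-! ### Angles and ratios in terms of dot and cross products -/

open MvPolynomial in
/-- The inner product of `p_j - p_i` and `p_k - p_i`, as a polynomial. -/
noncomputable def dotPoly {n : ℕ} (i j k : Fin n) : MvPolynomial (Fin n × Fin 2) ℤ :=
  (X (j, 0) - X (i, 0)) * (X (k, 0) - X (i, 0)) + (X (j, 1) - X (i, 1)) * (X (k, 1) - X (i, 1))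

open MvPolynomial in
/-- The determinant of `p_j - p_i` and `p_k - p_i`, as a polynomial. -/
noncomputable def crossPoly {n : ℕ} (i j k : Fin n) : MvPolynomial (Fin n × Fin 2) ℤ :=
  (X (j, 0) - X (i, 0)) * (X (k, 1) - X (i, 1)) - (X (j, 1) - X (i, 1)) * (X (k, 0) - X (i, 0))

theorem evalAt_dotPoly {n : ℕ} (x : Config n) (i j k : Fin n) :
    evalAt x (dotPoly i j k) = (x j 0 - x i 0) * (x k 0 - x i 0) +
      (x j 1 - x i 1) * (x k 1 - x i 1) := by
  simp [dotPoly]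

theorem evalAt_crossPoly {n : ℕ} (x : Config n) (i j k : Fin n) :
    evalAt x (crossPoly i j k) = (x j 0 - x i 0) * (x k 1 - x i 1) -
      (x j 1 - x i 1) * (x k 0 - x i 0) := by
  simp [crossPoly]

theorem evalAt_dotPoly_self {n : ℕ} (x : Config n) (i j : Fin n) :
    evalAt x (dotPoly i j j) = ‖x j - x i‖ ^ 2 := by
  rw [evalAt_dotPoly, EuclideanSpace.norm_sq_eq, Fin.sum_univ_two]
  simp only [PiLp.sub_apply, Real.norm_eq_abs, sq_abs]
  ring

theorem dotPoly_self_ne_zero {n : ℕ} {i j : Fin n} (hij : i ≠ j) : dotPoly i j j ≠ 0 := by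
  intro h
  have := evalAt_dotPoly (fun v => if v = j then !₂[1, 0] else 0) i j j
  rw [h, map_zero] at this
  simp [hij] at this

theorem crossPoly_ne_zero {n : ℕ} {i j k : Fin n} (hij : i ≠ j) (hik : i ≠ k) (hjk : j ≠ k) :
    crossPoly i j k ≠ 0 := by
  intro h
  have := evalAt_crossPoly
    (fun v => if v = j then !₂[1, 0] else if v = k then !₂[0, 1] else 0) i j k
  rw [h, map_zero] at this
  simp [hij, hik, hjk.symm] at this

theorem IsGeneric.injective {n : ℕ} {p : Config n} (hp : IsGeneric p) : Function.Injective p := by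
  intro i j hij
  by_contra hne
  apply hp.evalAt_ne_zero (dotPoly_self_ne_zero hne)
  rw [evalAt_dotPoly_self, hij, sub_self, norm_zero, zero_pow two_ne_zero]

theorem inner_bearing {n : ℕ} (x : Config n) (i j k : Fin n) :
    inner ℝ (bearing x i j) (bearing x i k) =
      evalAt x (dotPoly i j k) / (‖x j - x i‖ * ‖x k - x i‖) := by
  rw [evalAt_dotPoly, bearing, bearing, real_inner_smul_left, real_inner_smul_right,
    PiLp.inner_apply, Fin.sum_univ_two]
  simp only [PiLp.sub_apply, RCLike.inner_apply, conj_trivial, div_eq_mul_inv, mul_inv]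
  ring

theorem inner_quarterTurn_bearing {n : ℕ} (x : Config n) (i j k : Fin n) :
    inner ℝ (bearing x i k) (quarterTurn (bearing x i j)) =
      evalAt x (crossPoly i j k) / (‖x j - x i‖ * ‖x k - x i‖) := by
  rw [evalAt_crossPoly, bearing, bearing, real_inner_smul_left, PiLp.inner_apply, Fin.sum_univ_two]
  simp [quarterTurn, div_eq_mul_inv]
  ring

/-- In a right triangle with legs `c`, `d` and hypotenuse `r`, the sine `c / r` and the tangent `c /
d` belong to the same angle; `c` may have either sign. -/
theorem arccos_div_norm {c d r : ℝ} (hd : 0 < d) (hr : 0 < r) (h : r ^ 2 = c ^ 2 + d ^ 2) :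
    Real.arccos (c / r) = Real.pi / 2 - Real.arctan (c / d) := by
  rw [Real.arccos_eq_pi_div_two_sub_arcsin, Real.arctan_eq_arcsin]
  congr 2
  have : 1 + (c / d) ^ 2 = (r / d) ^ 2 := by field_simp; linarith
  rw [this, Real.sqrt_sq (by positivity)]
  field_simp

/-- Off the collinear triples, the signed angle is a branch of the inverse cotangent. -/
theorem signedAngle_eq {n : ℕ} {x : Config n} {i j k : Fin n}
    (h : evalAt x (crossPoly i j k) ≠ 0) :
    signedAngle x i j k = (if 0 < evalAt x (crossPoly i j k) then Real.pi / 2 else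
      3 * Real.pi / 2) - Real.arctan (evalAt x (dotPoly i j k) / evalAt x (crossPoly i j k)) := by
  have hj : 0 < ‖x j - x i‖ := by
    rw [norm_pos_iff]
    intro h0
    apply h
    have h1 : ∀ a, x j a - x i a = 0 := fun a => by simpa using congrArg (fun v : Plane => v a) h0
    simp [evalAt_crossPoly, h1]
  have hk : 0 < ‖x k - x i‖ := by
    rw [norm_pos_iff]
    intro h0
    apply h
    have h1 : ∀ a, x k a - x i a = 0 := fun a => by simpa using congrArg (fun v : Plane => v a) h0
    simp [evalAt_crossPoly, h1]
  have hr : 0 < ‖x j - x i‖ * ‖x k - x i‖ := mul_pos hj hk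
  -- Lagrange's identity.
  have hsq : (‖x j - x i‖ * ‖x k - x i‖) ^ 2 =
      evalAt x (dotPoly i j k) ^ 2 + evalAt x (crossPoly i j k) ^ 2 := by
    rw [mul_pow, ← evalAt_dotPoly_self, ← evalAt_dotPoly_self]
    simp only [evalAt_dotPoly, evalAt_crossPoly]
    ring
  rw [signedAngle, inner_bearing, inner_quarterTurn_bearing]
  rcases lt_or_gt_of_ne h with hneg | hpos
  -- For a negative cross product both numerator and denominator change sign: `2π - arccos y = π +
  -- arccos (-y)` produces the constant `3π/2` and leaves dot/cross unchanged.
  · rw [if_neg (not_le.2 (div_neg_of_neg_of_pos hneg hr)), if_neg (not_lt.2 hneg.le),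
      ← neg_neg (evalAt x (dotPoly i j k) / (_ * _)), Real.arccos_neg, ← neg_div,
      arccos_div_norm (neg_pos.2 hneg) hr (by rw [hsq]; ring), neg_div_neg_eq]
    ring
  · rw [if_pos (div_pos hpos hr).le, if_pos hpos, arccos_div_norm hpos hr hsq]

theorem ratioOfDistance_eq {n : ℕ} (x : Config n) (i j k : Fin n) :
    ratioOfDistance x i j k = √(evalAt x (dotPoly i k k) / evalAt x (dotPoly i j j)) := by
  rw [evalAt_dotPoly_self, evalAt_dotPoly_self, ← div_pow, Real.sqrt_sq (by positivity),
    ratioOfDistance]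

/-! ### Algebraic measurements and their gradients -/

/-- All the index triples `(u, v, w)` with `v, w` neighbours of `u` and `v < w`. -/
def BipGraph.triples {n : ℕ} (G : BipGraph n) : Set (Fin n × Fin n × Fin n) :=
  {t | G.graph.Adj t.1 t.2.1 ∧ G.graph.Adj t.1 t.2.2 ∧ t.2.1 < t.2.2}

theorem BipGraph.triples_subset {n : ℕ} (G : BipGraph n) : G.triples ⊆ G.complete.triples :=
  fun _ ht => ⟨ht.1.ne, ht.2.1.ne, ht.2.2⟩

theorem BipGraph.triples_eq {n : ℕ} (G : BipGraph n) : G.triples = G.TA ∪ G.TD := by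
  ext t
  have : t.1 ∈ G.VA ∪ G.VD := G.cover ▸ Set.mem_univ _
  simp only [BipGraph.triples, BipGraph.TA, BipGraph.TD, Set.mem_ofPred_eq, Set.mem_union] at this ⊢
  tauto

theorem BipGraph.mem_VD_iff {n : ℕ} (G : BipGraph n) (u : Fin n) : u ∈ G.VD ↔ u ∉ G.VA := by
  have h1 : u ∈ G.VA ∪ G.VD := G.cover ▸ Set.mem_univ _
  have h2 : u ∉ G.VA ∩ G.VD := G.disj ▸ Set.notMem_empty _
  simp only [Set.mem_union, Set.mem_inter_iff] at h1 h2
  tauto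

open Classical in
/-- The component of the rigidity function at a triple of nodes. -/
noncomputable def measurement {n : ℕ} (G : BipGraph n) (t : Fin n × Fin n × Fin n) (x : Config n) :
    ℝ :=
  if t.1 ∈ G.VA then signedAngle x t.1 t.2.1 t.2.2 else ratioOfDistance x t.1 t.2.1 t.2.2

open Classical in
/-- The numerator of the algebraic measurement at a triple of nodes. -/
noncomputable def num {n : ℕ} (G : BipGraph n) (t : Fin n × Fin n × Fin n) :
    MvPolynomial (Fin n × Fin 2) ℤ :=
  if t.1 ∈ G.VA then dotPoly t.1 t.2.1 t.2.2 else dotPoly t.1 t.2.2 t.2.2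

open Classical in
/-- The denominator of the algebraic measurement at a triple of nodes. -/
noncomputable def den {n : ℕ} (G : BipGraph n) (t : Fin n × Fin n × Fin n) :
    MvPolynomial (Fin n × Fin 2) ℤ :=
  if t.1 ∈ G.VA then crossPoly t.1 t.2.1 t.2.2 else dotPoly t.1 t.2.1 t.2.1

/-- The algebraic measurement at a triple of nodes: the cotangent of the signed angle, or the square
of the ratio of distance. -/
noncomputable def algMeasurement {n : ℕ} (G : BipGraph n) (t : Fin n × Fin n × Fin n)
    (x : Config n) : ℝ :=
  evalAt x (num G t) / evalAt x (den G t)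

/-- The gradient of the algebraic measurement, up to a factor. -/
noncomputable def grad {n : ℕ} (G : BipGraph n) (t : Fin n × Fin n × Fin n) :
    Fin n × Fin 2 → MvPolynomial (Fin n × Fin 2) ℤ :=
  quotientGradient (num G t) (den G t)

theorem den_ne_zero {n : ℕ} {G : BipGraph n} {t : Fin n × Fin n × Fin n}
    (ht : t ∈ G.complete.triples) : den G t ≠ 0 := by
  obtain ⟨h1, h2, h3⟩ := ht
  unfold den
  split_ifs
  · exact crossPoly_ne_zero h1.ne h2.ne h3.ne
  · exact dotPoly_self_ne_zero h1.ne

/-- Near a generic configuration, a measurement is a nonsingular injective function of the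
algebraic measurement. -/
theorem exists_measurement_eq {n : ℕ} {G : BipGraph n} {p : Config n} (hp : IsGeneric p)
    {t : Fin n × Fin n × Fin n} (ht : t ∈ G.complete.triples) :
    ∃ Φ : ℝ → ℝ, (∀ᶠ x in 𝓝 p, measurement G t x = Φ (algMeasurement G t x)) ∧
      (∀ x y, Φ (algMeasurement G t x) = Φ (algMeasurement G t y) →
        algMeasurement G t x = algMeasurement G t y) ∧
      ∃ c, c ≠ 0 ∧ HasDerivAt Φ c (algMeasurement G t p) := by
  have hden := hp.evalAt_ne_zero (den_ne_zero ht)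
  have hev := eventually_evalAt_ne_zero hden
  by_cases hA : t.1 ∈ G.VA
  · simp only [measurement, algMeasurement, num, den, if_pos hA] at hden hev ⊢
    have hcont := (contDiff_evalAt (crossPoly t.1 t.2.1 t.2.2)).continuous.continuousAt (x := p)
    -- The branch is frozen at its value at `p`; the cross product keeps its sign nearby.
    refine ⟨fun y => (if 0 < evalAt p (crossPoly t.1 t.2.1 t.2.2) then Real.pi / 2 else
      3 * Real.pi / 2) - Real.arctan y, ?_, fun x y h => ?_,
      -(1 / (1 + (evalAt p (dotPoly t.1 t.2.1 t.2.2) / evalAt p (crossPoly t.1 t.2.1 t.2.2)) ^ 2)),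
      ?_, (Real.hasDerivAt_arctan _).const_sub _⟩
    · rcases lt_or_gt_of_ne hden with hneg | hpos
      · filter_upwards [hcont.eventually_lt_const hneg] with x hx
        rw [signedAngle_eq hx.ne, if_neg (not_lt.2 hx.le), if_neg (not_lt.2 hneg.le)]
      · filter_upwards [hcont.eventually_const_lt hpos] with x hx
        rw [signedAngle_eq hx.ne', if_pos hx, if_pos hpos]
    · exact Real.arctan_injective (sub_right_injective h)
    · rw [neg_ne_zero]
      positivity
  · simp only [measurement, algMeasurement, num, den, if_neg hA] at hden hev ⊢
    have hnum := hp.evalAt_ne_zero (dotPoly_self_ne_zero ht.2.1.ne)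
    refine ⟨Real.sqrt, Eventually.of_forall fun x => ratioOfDistance_eq x _ _ _, fun x y h => ?_,
      _, ?_, Real.hasDerivAt_sqrt (div_ne_zero hnum hden)⟩
    -- Injectivity of the root needs nonnegative arguments; this holds also where the denominator
    -- vanishes, since the quotient is then 0.
    · have hnn : ∀ x : Config n, 0 ≤ evalAt x (dotPoly t.1 t.2.2 t.2.2) /
          evalAt x (dotPoly t.1 t.2.1 t.2.1) := fun x => by
        rw [evalAt_dotPoly_self, evalAt_dotPoly_self]
        positivity
      exact (Real.sqrt_inj (hnn x) (hnn y)).1 h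
    · have : 0 < evalAt p (dotPoly t.1 t.2.2 t.2.2) / evalAt p (dotPoly t.1 t.2.1 t.2.1) := by
        refine lt_of_le_of_ne ?_ (div_ne_zero hnum hden).symm
        rw [evalAt_dotPoly_self, evalAt_dotPoly_self]
        positivity
      have := Real.sqrt_pos.2 this
      positivity

theorem hasFDerivAt_algMeasurement {n : ℕ} {G : BipGraph n} {t : Fin n × Fin n × Fin n}
    {x : Config n} (hx : evalAt x (den G t) ≠ 0) :
    HasFDerivAt (algMeasurement G t) ((evalAt x (den G t) ^ 2)⁻¹ • form (evalAt x ∘ grad G t)) x :=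
  hasFDerivAt_quotient _ _ hx

theorem contDiffAt_algMeasurement {n : ℕ} {G : BipGraph n} {t : Fin n × Fin n × Fin n}
    {x : Config n} (hx : evalAt x (den G t) ≠ 0) : ContDiffAt ℝ 1 (algMeasurement G t) x :=
  (contDiff_evalAt _).contDiffAt.div (contDiff_evalAt _).contDiffAt hx

theorem fderiv_algMeasurement_eq_zero_iff {n : ℕ} {G : BipGraph n} {t : Fin n × Fin n × Fin n}
    {x : Config n} (hx : evalAt x (den G t) ≠ 0) (δ : Config n) :
    fderiv ℝ (algMeasurement G t) x δ = 0 ↔ form (evalAt x ∘ grad G t) δ = 0 := by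
  rw [(hasFDerivAt_algMeasurement hx).fderiv]
  simp [hx]

theorem eventually_measurement_eq_iff {n : ℕ} {G : BipGraph n} {p : Config n} (hp : IsGeneric p) :
    ∀ᶠ x in 𝓝 p, ∀ t ∈ G.complete.triples,
      (measurement G t x = measurement G t p ↔ algMeasurement G t x = algMeasurement G t p) := by
  rw [eventually_all]
  intro t
  rw [eventually_imp_distrib_left]
  intro ht
  obtain ⟨Φ, hev, hinj, -⟩ := exists_measurement_eq (G := G) hp ht
  filter_upwards [hev] with x hx
  rw [hx, hev.self_of_nhds]
  exact ⟨hinj _ _, fun h => by rw [h]⟩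

theorem exists_fderiv_measurement {n : ℕ} {G : BipGraph n} {p : Config n} (hp : IsGeneric p)
    {t : Fin n × Fin n × Fin n} (ht : t ∈ G.complete.triples) :
    ∃ c : ℝ, c ≠ 0 ∧ fderiv ℝ (measurement G t) p = c • form (evalAt p ∘ grad G t) := by
  obtain ⟨Φ, hev, -, c, hc, hΦ⟩ := exists_measurement_eq (G := G) hp ht
  have hden := hp.evalAt_ne_zero (den_ne_zero ht)
  have h := (hΦ.comp_hasFDerivAt p (hasFDerivAt_algMeasurement hden)).congr_of_eventuallyEq hev
  refine ⟨c * (evalAt p (den G t) ^ 2)⁻¹, by positivity, ?_⟩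
  rw [h.fderiv, smul_smul]

theorem rigidityFunction_eq_iff {n : ℕ} (G : BipGraph n) (x y : Config n) :
    rigidityFunction G x = rigidityFunction G y ↔
      ∀ t ∈ G.triples, measurement G t x = measurement G t y := by
  rw [G.triples_eq, funext_iff, Sum.forall]
  constructor
  · rintro ⟨h1, h2⟩ t (ht | ht)
    · simpa [measurement, rigidityFunction, show t.1 ∈ G.VA from ht.1] using h1 ⟨t, ht⟩
    · simpa [measurement, rigidityFunction, (G.mem_VD_iff _).1 ht.1] using h2 ⟨t, ht⟩
  · refine fun h => ⟨fun t => ?_, fun t => ?_⟩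
    · simpa [measurement, rigidityFunction, show t.1.1 ∈ G.VA from t.2.1] using
        h t.1 (Or.inl t.2)
    · simpa [measurement, rigidityFunction, (G.mem_VD_iff _).1 t.2.1] using
        h t.1 (Or.inr t.2)

/-- By the chain rule each row of the rigidity matrix is a nonzero multiple of the corresponding
polynomial gradient, so the two have the same annihilator. -/
theorem isInfinitesimalMotion_iff {n : ℕ} {G : BipGraph n} {p : Config n} (hp : IsGeneric p)
    (δ : Config n) :
    IsInfinitesimalMotion G p δ ↔ ∀ t ∈ G.triples, form (evalAt p ∘ grad G t) δ = 0 := by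
  have key : ∀ (s : G.TA ⊕ G.TD) (t : Fin n × Fin n × Fin n), t ∈ G.triples →
      (∀ x, rigidityFunction G x s = measurement G t x) →
      ((rigidityMatrix G p).mulVec (fun a => δ a.1 a.2) s = 0 ↔
        form (evalAt p ∘ grad G t) δ = 0) := by
    intro s t ht hs
    obtain ⟨c, hc, hfd⟩ := exists_fderiv_measurement (G := G) hp (G.triples_subset ht)
    have hrow : rigidityMatrix G p s = c • (evalAt p ∘ grad G t) := by
      ext a
      simp only [rigidityMatrix, Matrix.of_apply, hs]
      rw [show (fun q : Config n => measurement G t q) = measurement G t from rfl, hfd,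
        smul_apply, form_basis, Pi.smul_apply]
    rw [Matrix.mulVec, hrow, smul_dotProduct, ← form_apply, smul_eq_mul, mul_eq_zero,
      or_iff_right hc]
  have hA : ∀ t : G.TA, ∀ x, rigidityFunction G x (Sum.inl t) = measurement G t.1 x :=
    fun t x => by simp [measurement, rigidityFunction, show t.1.1 ∈ G.VA from t.2.1]
  have hD : ∀ t : G.TD, ∀ x, rigidityFunction G x (Sum.inr t) = measurement G t.1 x :=
    fun t x => by simp [measurement, rigidityFunction, (G.mem_VD_iff _).1 t.2.1]
  rw [IsInfinitesimalMotion, funext_iff, Sum.forall]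
  constructor
  · rintro ⟨h1, h2⟩ t ht
    rcases G.triples_eq ▸ ht with h | h
    · exact (key _ t ht (hA ⟨t, h⟩)).1 (h1 ⟨t, h⟩)
    · exact (key _ t ht (hD ⟨t, h⟩)).1 (h2 ⟨t, h⟩)
  · intro h
    have hsub := G.triples_eq
    refine ⟨fun t => ?_, fun t => ?_⟩
    · have ht : t.1 ∈ G.triples := by rw [hsub]; exact Or.inl t.2
      exact (key _ t.1 ht (hA t)).2 (h _ ht)
    · have ht : t.1 ∈ G.triples := by rw [hsub]; exact Or.inr t.2
      exact (key _ t.1 ht (hD t)).2 (h _ ht)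

theorem exists_basis_triples {n : ℕ} (G : BipGraph n) (p : Config n) :
    ∃ s ⊆ G.triples, LinearIndependent ℝ (fun i : s => evalAt p ∘ grad G i) ∧
      ∀ t ∈ G.triples,
        evalAt p ∘ grad G t ∈ Submodule.span ℝ (Set.range fun i : s => evalAt p ∘ grad G i) := by
  obtain ⟨s, hs, -, hspan, hli⟩ := exists_linearIndepOn_extension
    (linearIndepOn_empty ℝ fun t => evalAt p ∘ grad G t) (Set.empty_subset G.triples)
  refine ⟨s, hs, hli, fun t ht => ?_⟩
  have := hspan (Set.mem_image_of_mem _ ht)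
  rwa [Set.image_eq_range] at this

/-- The point `x` need not be generic. This supplies the kernel inclusion on a whole neighbourhood
of a generic configuration, as the constant-rank argument requires. -/
theorem form_eq_zero_of_mul_eq_sum {n : ℕ} {ι : Type*} [Fintype ι]
    {w : ι → Fin n × Fin 2 → MvPolynomial (Fin n × Fin 2) ℤ}
    {u : Fin n × Fin 2 → MvPolynomial (Fin n × Fin 2) ℤ}
    {c : MvPolynomial (Fin n × Fin 2) ℤ} {b : ι → MvPolynomial (Fin n × Fin 2) ℤ}
    (h : ∀ a, c * u a = ∑ i, b i * w i a) {x : Config n} (hc : evalAt x c ≠ 0) {δ : Config n}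
    (hδ : ∀ i, form (evalAt x ∘ w i) δ = 0) : form (evalAt x ∘ u) δ = 0 := by
  have hu : evalAt x c • (evalAt x ∘ u) = ∑ i, evalAt x (b i) • (evalAt x ∘ w i) := by
    ext a
    simpa using congrArg (evalAt x) (h a)
  simp only [form_apply] at hδ ⊢
  have := congrArg (· ⬝ᵥ fun a => δ a.1 a.2) hu
  simpa [smul_dotProduct, sum_dotProduct, hδ, hc] using this

/-- Linear dependence of polynomial vectors holds at all generic configurations or at none. -/
theorem IsGeneric.mem_span {n : ℕ} {p q : Config n} (hp : IsGeneric p) (hq : IsGeneric q)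
    {ι : Type*} [Fintype ι] {w : ι → Fin n × Fin 2 → MvPolynomial (Fin n × Fin 2) ℤ}
    {u : Fin n × Fin 2 → MvPolynomial (Fin n × Fin 2) ℤ}
    (hw : LinearIndependent ℝ fun i => evalAt p ∘ w i)
    (hu : evalAt p ∘ u ∈ Submodule.span ℝ (Set.range fun i => evalAt p ∘ w i)) :
    evalAt q ∘ u ∈ Submodule.span ℝ (Set.range fun i => evalAt q ∘ w i) := by
  obtain ⟨c, b, hc, h⟩ := hp.exists_mul_eq_sum hw hu
  have hcq := hq.evalAt_ne_zero hc
  have hu : evalAt q c • (evalAt q ∘ u) = ∑ i, evalAt q (b i) • (evalAt q ∘ w i) := by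
    ext a
    simpa using congrArg (evalAt q) (h a)
  rw [← Submodule.smul_mem_iff _ hcq, hu]
  exact Submodule.sum_mem _ fun i _ => Submodule.smul_mem _ _ (Submodule.subset_span ⟨i, rfl⟩)

theorem exists_form_eq {n : ℕ} {ι : Type*} [Fintype ι] {w : ι → Fin n × Fin 2 → ℝ}
    (hw : LinearIndependent ℝ w) (y : ι → ℝ) : ∃ δ : Config n, ∀ i, form (w i) δ = y i := by
  obtain ⟨d, hd⟩ := exists_dotProduct_eq hw y
  exact ⟨fun i => WithLp.toLp 2 fun k => d (i, k), fun i => by rw [form_apply]; exact hd i⟩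

theorem hasStrictFDerivAt_algMeasurements {n : ℕ} {G : BipGraph n} {ι : Type*} [Fintype ι]
    {f : ι → Fin n × Fin n × Fin n} {x : Config n} (hx : ∀ i, evalAt x (den G (f i)) ≠ 0) :
    HasStrictFDerivAt (fun y i => algMeasurement G (f i) y)
      (ContinuousLinearMap.pi fun i =>
        (evalAt x (den G (f i)) ^ 2)⁻¹ • form (evalAt x ∘ grad G (f i))) x :=
  hasStrictFDerivAt_pi.2 fun i =>
    (contDiffAt_algMeasurement (hx i)).hasStrictFDerivAt' (hasFDerivAt_algMeasurement (hx i))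
      one_ne_zero

theorem surjective_pi_grad {n : ℕ} {G : BipGraph n} {ι : Type*} [Fintype ι]
    {f : ι → Fin n × Fin n × Fin n} {x : Config n} (hx : ∀ i, evalAt x (den G (f i)) ≠ 0)
    (hli : LinearIndependent ℝ fun i => evalAt x ∘ grad G (f i)) :
    Function.Surjective (ContinuousLinearMap.pi fun i =>
        (evalAt x (den G (f i)) ^ 2)⁻¹ • form (evalAt x ∘ grad G (f i))) := by
  intro y
  obtain ⟨δ, hδ⟩ := exists_form_eq hli fun i => evalAt x (den G (f i)) ^ 2 * y i
  refine ⟨δ, funext fun i => ?_⟩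
  have := hx i
  simp only [ContinuousLinearMap.pi_apply, smul_apply, hδ, smul_eq_mul]
  field_simp

/-! ### Rigidity as a rank condition -/

/-- Near a generic configuration, the independent measurements determine the dependent ones. -/
theorem eventually_algMeasurement_eq {n : ℕ} {G : BipGraph n} {p : Config n} (hp : IsGeneric p)
    {s : Set (Fin n × Fin n × Fin n)} (hs : s ⊆ G.complete.triples)
    (hli : LinearIndependent ℝ fun i : s => evalAt p ∘ grad G i)
    {t : Fin n × Fin n × Fin n} (ht : t ∈ G.complete.triples)
    (hspan : evalAt p ∘ grad G t ∈
      Submodule.span ℝ (Set.range fun i : s => evalAt p ∘ grad G i)) :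
    ∀ᶠ x in 𝓝 p, (∀ i ∈ s, algMeasurement G i x = algMeasurement G i p) →
      algMeasurement G t x = algMeasurement G t p := by
  have : Fintype s := Fintype.ofFinite s
  obtain ⟨c, b, hc, hrel⟩ := hp.exists_mul_eq_sum hli hspan
  have hden : ∀ i : s, evalAt p (den G i) ≠ 0 :=
    fun i => hp.evalAt_ne_zero (den_ne_zero (hs i.2))
  have hdent := hp.evalAt_ne_zero (den_ne_zero ht)
  have hstrict := hasStrictFDerivAt_algMeasurements (G := G) (f := fun i : s => i.1) hden
  have hmain := eventually_eq_of_ker_fderiv_le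
    (G := fun y (i : s) => algMeasurement G i y) (h := algMeasurement G t) (p := p)
    (contDiffAt_pi.2 fun i => contDiffAt_algMeasurement (hden i))
    (contDiffAt_algMeasurement hdent)
    (by rw [hstrict.hasFDerivAt.fderiv]; exact surjective_pi_grad hden hli)
    (by
      have h1 : ∀ᶠ x in 𝓝 p, ∀ i : s, evalAt x (den G i) ≠ 0 :=
        eventually_all.2 fun i => eventually_evalAt_ne_zero (hden i)
      filter_upwards [h1, eventually_evalAt_ne_zero hdent,
        eventually_evalAt_ne_zero (hp.evalAt_ne_zero hc)] with x hx1 hx2 hx3 v hv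
      rw [fderiv_algMeasurement_eq_zero_iff hx2]
      refine form_eq_zero_of_mul_eq_sum hrel hx3 fun i => ?_
      rw [← fderiv_algMeasurement_eq_zero_iff (hx1 i),
        (hasFDerivAt_algMeasurement (hx1 i)).fderiv]
      rw [(hasStrictFDerivAt_algMeasurements (f := fun i : s => i.1) hx1).hasFDerivAt.fderiv] at hv
      exact congrFun hv i)
  filter_upwards [hmain] with x hx h
  exact hx (funext fun i => h i i.2)

/-- A measurement independent of a family of measurements is not determined by it. -/
theorem not_eventually_algMeasurement_eq {n : ℕ} {G : BipGraph n} {p : Config n}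
    (hp : IsGeneric p) {s : Set (Fin n × Fin n × Fin n)} (hs : s ⊆ G.complete.triples)
    (hli : LinearIndependent ℝ fun i : s => evalAt p ∘ grad G i)
    {t : Fin n × Fin n × Fin n} (ht : t ∈ G.complete.triples)
    (hspan : evalAt p ∘ grad G t ∉
      Submodule.span ℝ (Set.range fun i : s => evalAt p ∘ grad G i)) :
    ¬ ∀ᶠ x in 𝓝 p, (∀ i ∈ s, algMeasurement G i x = algMeasurement G i p) →
      algMeasurement G t x = algMeasurement G t p := by
  intro hev
  have : Fintype s := Fintype.ofFinite s
  set f : Option s → Fin n × Fin n × Fin n := fun o => o.elim t Subtype.val with hf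
  have hden : ∀ o, evalAt p (den G (f o)) ≠ 0 := by
    rintro (_ | i)
    · exact hp.evalAt_ne_zero (den_ne_zero ht)
    · exact hp.evalAt_ne_zero (den_ne_zero (hs i.2))
  have hli' : LinearIndependent ℝ fun o => evalAt p ∘ grad G (f o) :=
    linearIndependent_option.2 ⟨hli, hspan⟩
  -- With `t` adjoined the measurements still form a submersion at `p`, hence map neighbourhoods of
  -- `p` onto neighbourhoods of the image.
  have hmap := (hasStrictFDerivAt_algMeasurements hden).map_nhds_eq_of_surj
    (LinearMap.range_eq_top.2 (surjective_pi_grad hden hli'))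
  have hev' := image_mem_map (m := fun y o => algMeasurement G (f o) y) hev
  rw [hmap] at hev'
  set y₀ : Option s → ℝ := fun o => algMeasurement G (f o) p with hy₀
  -- Perturbing only the coordinate `none` gives values, attained near `p`, where the measurement at
  -- `t` changes and those in `s` do not.
  have hcurve : Tendsto (fun ε : ℝ => y₀ + ε • Pi.single none 1) (𝓝[≠] 0) (𝓝 y₀) := by
    have : Continuous fun ε : ℝ => y₀ + ε • (Pi.single none 1 : Option s → ℝ) := by fun_prop
    exact (this.tendsto' 0 y₀ (by simp)).mono_left nhdsWithin_le_nhds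
  obtain ⟨ε, ⟨x, hx, hxε⟩, hε⟩ := ((hcurve.eventually hev').and self_mem_nhdsWithin).exists
  have h1 := hx fun i hi => by
    simpa [hf, hy₀] using congrFun hxε (some ⟨i, hi⟩)
  have h2 := congrFun hxε none
  simp only [hf, hy₀, Option.elim_none, Pi.add_apply, Pi.smul_apply, Pi.single_eq_same, smul_eq_mul,
    mul_one, h1] at h2
  exact hε (by simpa using h2)

theorem eventually_nonCollocated {n : ℕ} {p : Config n} (hp : IsGeneric p) :
    ∀ᶠ x in 𝓝 p, NonCollocated x := by
  have : ∀ᶠ x in 𝓝 p, ∀ i j : Fin n, i ≠ j → x i ≠ x j := by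
    simp only [eventually_all]
    intro i j hij
    have h : Continuous fun x : Config n => x i - x j := by fun_prop
    filter_upwards [h.continuousAt.eventually_ne (sub_ne_zero.2 (hp.injective.ne hij))] with x hx
    exact sub_ne_zero.1 hx
  filter_upwards [this] with x hx i j hij
  by_contra hne
  exact hx i j hne hij

theorem measurement_complete {n : ℕ} (G : BipGraph n) : measurement G.complete = measurement G :=
  rfl

/-- Non-collocation is an open condition, and near `p` equality of measurements amounts to equality
of algebraic ones, so both fibres become level sets of rational functions. -/
theorem isRigid_iff_eventually {n : ℕ} {G : BipGraph n} {p : Config n} (hp : IsGeneric p) :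
    IsRigid G p ↔ ∀ᶠ x in 𝓝 p,
      (∀ t ∈ G.triples, algMeasurement G t x = algMeasurement G t p) →
      ∀ t ∈ G.complete.triples, algMeasurement G t x = algMeasurement G t p := by
  have hm := eventually_measurement_eq_iff (G := G) hp
  have hfib : ∀ x, (∀ t ∈ G.complete.triples, (measurement G t x = measurement G t p ↔
      algMeasurement G t x = algMeasurement G t p)) → NonCollocated x →
      ((x ∈ fibre G p ↔ ∀ t ∈ G.triples, algMeasurement G t x = algMeasurement G t p) ∧
      (x ∈ fibre G.complete p ↔
        ∀ t ∈ G.complete.triples, algMeasurement G t x = algMeasurement G t p)) := by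
    intro x hx hnc
    constructor
    · change NonCollocated x ∧ _ ↔ _
      rw [and_iff_right hnc, rigidityFunction_eq_iff]
      exact forall₂_congr fun t ht => hx t (G.triples_subset ht)
    · change NonCollocated x ∧ _ ↔ _
      rw [and_iff_right hnc, rigidityFunction_eq_iff, measurement_complete]
      exact forall₂_congr fun t ht => hx t ht
  constructor
  · rintro ⟨U, hU, hpU, heq⟩
    filter_upwards [hm, eventually_nonCollocated hp, hU.mem_nhds hpU] with x hx hnc hxU h
    have : x ∈ fibre G.complete p ∩ U := heq ▸ ⟨(hfib x hx hnc).1.2 h, hxU⟩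
    exact (hfib x hx hnc).2.1 this.1
  · intro hev
    obtain ⟨U, hUsub, hU, hpU⟩ := mem_nhds_iff.1 ((hm.and (eventually_nonCollocated hp)).and hev)
    refine ⟨U, hU, hpU, Set.ext fun x => and_congr_left fun hxU => ?_⟩
    obtain ⟨⟨hx, hnc⟩, h⟩ := hUsub hxU
    rw [(hfib x hx hnc).1, (hfib x hx hnc).2]
    exact ⟨h, fun h' t ht => h' t (G.triples_subset ht)⟩

/-- Rigidity at a generic configuration is a rank condition. -/
theorem isRigid_iff_mem_span {n : ℕ} {G : BipGraph n} {p : Config n} (hp : IsGeneric p)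
    {s : Set (Fin n × Fin n × Fin n)} (hs : s ⊆ G.triples)
    (hli : LinearIndependent ℝ fun i : s => evalAt p ∘ grad G i)
    (hspan : ∀ t ∈ G.triples, evalAt p ∘ grad G t ∈
      Submodule.span ℝ (Set.range fun i : s => evalAt p ∘ grad G i)) :
    IsRigid G p ↔ ∀ t ∈ G.complete.triples, evalAt p ∘ grad G t ∈
      Submodule.span ℝ (Set.range fun i : s => evalAt p ∘ grad G i) := by
  have hsK := hs.trans G.triples_subset
  rw [isRigid_iff_eventually hp]
  constructor
  · intro hev t ht
    by_contra hnot
    -- The measurements in `s` determine all those of `G`, hence by rigidity also the one at `t`,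
    -- against its independence of `s`.
    have hG : ∀ᶠ x in 𝓝 p, ∀ t, t ∈ G.triples →
        (∀ i ∈ s, algMeasurement G i x = algMeasurement G i p) →
          algMeasurement G t x = algMeasurement G t p :=
      eventually_all.2 fun t => eventually_imp_distrib_left.2 fun ht =>
        eventually_algMeasurement_eq hp hsK hli (G.triples_subset ht) (hspan t ht)
    refine not_eventually_algMeasurement_eq hp hsK hli ht hnot ?_
    filter_upwards [hev, hG] with x h1 h2 h
    exact h1 (fun t ht => h2 t ht h) t ht
  · intro h
    have hK : ∀ᶠ x in 𝓝 p, ∀ t, t ∈ G.complete.triples →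
        (∀ i ∈ s, algMeasurement G i x = algMeasurement G i p) →
          algMeasurement G t x = algMeasurement G t p :=
      eventually_all.2 fun t => eventually_imp_distrib_left.2 fun ht =>
        eventually_algMeasurement_eq hp hsK hli ht (h t ht)
    filter_upwards [hK] with x hx h' t ht
    exact hx t ht fun i hi => h' i (hs hi)

/-- The index set `s` chosen at `p` is also a basis of the rows of `G` at `q`, so the rank criterion
is tested with the same `s` at both configurations. -/
theorem IsRigid.isGenericallyRigid {n : ℕ} {G : BipGraph n} {p : Config n} (hp : IsGeneric p)
    (h : IsRigid G p) : IsGenericallyRigid G := by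
  intro q hq
  obtain ⟨s, hs, hli, hspan⟩ := exists_basis_triples G p
  have : Fintype s := Fintype.ofFinite s
  rw [isRigid_iff_mem_span hp hs hli hspan] at h
  rw [isRigid_iff_mem_span hq hs (hq.linearIndependent_iff.2 (hp.linearIndependent_iff.1 hli))
    fun t ht => hp.mem_span hq hli (hspan t ht)]
  exact fun t ht => hp.mem_span hq hli (h t ht)

/-! ### Trivial motions and infinitesimal rigidity -/

/-- The trivial motions as the range of a linear map. -/
noncomputable def trivialMotion {n : ℕ} (p : Config n) : (Plane × ℝ × ℝ) →ₗ[ℝ] Config n where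
  toFun v i := v.1 + v.2.1 • quarterTurn (p i) + v.2.2 • p i
  map_add' v w := by
    ext i : 1
    simp only [Prod.fst_add, Prod.snd_add, add_smul, Pi.add_apply]
    abel
  map_smul' c v := by
    ext i : 1
    simp [smul_smul]

theorem isTrivialMotion_iff {n : ℕ} (p δ : Config n) :
    IsTrivialMotion p δ ↔ δ ∈ LinearMap.range (trivialMotion p) := by
  constructor
  · rintro ⟨ξ, a, b, h⟩
    exact ⟨(ξ, a, b), funext fun i => (h i).symm⟩
  · rintro ⟨⟨ξ, a, b⟩, rfl⟩
    exact ⟨ξ, a, b, fun i => rfl⟩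

theorem trivialMotion_injective {n : ℕ} {p : Config n} {i j : Fin n} (hij : p i ≠ p j) :
    Function.Injective (trivialMotion p) := by
  rw [← LinearMap.ker_eq_bot, LinearMap.ker_eq_bot']
  rintro ⟨ξ, a, b⟩ h
  have h' : ∀ k c, ξ c + a * quarterTurn (p k) c + b * p k c = 0 := fun k c => by
    simpa [trivialMotion] using congrArg (fun x : Config n => x k c) h
  have hi0 := h' i 0
  have hi1 := h' i 1
  have hj0 := h' j 0
  have hj1 := h' j 1
  simp only [quarterTurn, PiLp.toLp_apply, Matrix.cons_val_zero, Matrix.cons_val_one] at hi0 hi1 hj0 hj1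
  have hpos : 0 < (p i 0 - p j 0) ^ 2 + (p i 1 - p j 1) ^ 2 := by
    by_contra hle
    apply hij
    have h0 : p i 0 - p j 0 = 0 := by nlinarith [sq_nonneg (p i 0 - p j 0), sq_nonneg (p i 1 - p j 1)]
    have h1 : p i 1 - p j 1 = 0 := by nlinarith [sq_nonneg (p i 0 - p j 0), sq_nonneg (p i 1 - p j 1)]
    ext c
    fin_cases c
    · exact sub_eq_zero.1 h0
    · exact sub_eq_zero.1 h1
  -- Subtracting the equations at `i` and `j` removes `ξ`. Pairing the difference with the quarter
  -- turn of `p i - p j` isolates `a`; pairing it with `p i - p j` isolates `b`.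
  have ha : a = 0 := by
    refine (mul_eq_zero.1 (?_ : a * ((p i 0 - p j 0) ^ 2 + (p i 1 - p j 1) ^ 2) = 0)).resolve_right
      hpos.ne'
    linear_combination (p i 0 - p j 0) * (hi1 - hj1) - (p i 1 - p j 1) * (hi0 - hj0)
  have hb : b = 0 := by
    refine (mul_eq_zero.1 (?_ : b * ((p i 0 - p j 0) ^ 2 + (p i 1 - p j 1) ^ 2) = 0)).resolve_right
      hpos.ne'
    linear_combination (p i 0 - p j 0) * (hi0 - hj0) + (p i 1 - p j 1) * (hi1 - hj1)
  subst ha hb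
  have hξ : ξ = 0 := by
    ext c
    simpa using h' i c
  rw [hξ]
  rfl

/-- Displacing a configuration along a trivial motion is a similarity, so it does not change the
algebraic measurements. -/
theorem algMeasurement_add_smul_trivialMotion {n : ℕ} (G : BipGraph n)
    (t : Fin n × Fin n × Fin n) (p : Config n) (ξ : Plane) (a b r : ℝ)
    (hr : (1 + r * b) ^ 2 + (r * a) ^ 2 ≠ 0) :
    algMeasurement G t (p + r • trivialMotion p (ξ, a, b)) = algMeasurement G t p := by
  -- In complex notation, differences of points are multiplied by `(1 + r b) + i r a`, which scales
  -- dot and cross products by its squared modulus.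
  have hdot : ∀ i j k, evalAt (p + r • trivialMotion p (ξ, a, b)) (dotPoly i j k) =
      ((1 + r * b) ^ 2 + (r * a) ^ 2) * evalAt p (dotPoly i j k) := by
    intro i j k
    simp only [evalAt_dotPoly, trivialMotion, quarterTurn, LinearMap.coe_mk, AddHom.coe_mk,
      Pi.add_apply, Pi.smul_apply, PiLp.add_apply, PiLp.smul_apply, smul_eq_mul,
      Matrix.cons_val_zero, Matrix.cons_val_one]
    ring
  have hcross : ∀ i j k, evalAt (p + r • trivialMotion p (ξ, a, b)) (crossPoly i j k) =
      ((1 + r * b) ^ 2 + (r * a) ^ 2) * evalAt p (crossPoly i j k) := by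
    intro i j k
    simp only [evalAt_crossPoly, trivialMotion, quarterTurn, LinearMap.coe_mk, AddHom.coe_mk,
      Pi.add_apply, Pi.smul_apply, PiLp.add_apply, PiLp.smul_apply, smul_eq_mul,
      Matrix.cons_val_zero, Matrix.cons_val_one]
    ring
  unfold algMeasurement num den
  split_ifs
  · rw [hdot, hcross, mul_div_mul_left _ _ hr]
  · rw [hdot, hdot, mul_div_mul_left _ _ hr]

/-- The algebraic measurement is constant along `p + r • δ` for small `r`, so its derivative in the
direction `δ` vanishes. -/
theorem form_grad_trivialMotion {n : ℕ} {G : BipGraph n} {t : Fin n × Fin n × Fin n}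
    {p : Config n} (hp : evalAt p (den G t) ≠ 0) (v : Plane × ℝ × ℝ) :
    form (evalAt p ∘ grad G t) (trivialMotion p v) = 0 := by
  obtain ⟨ξ, a, b⟩ := v
  rw [← fderiv_algMeasurement_eq_zero_iff hp]
  set δ := trivialMotion p (ξ, a, b) with hδ
  have hline : HasDerivAt (fun r : ℝ => p + r • δ) δ 0 := by
    simpa using ((hasDerivAt_id (0 : ℝ)).smul_const δ).const_add p
  have hdiff : HasFDerivAt (algMeasurement G t) (fderiv ℝ (algMeasurement G t) p)
      (p + (0 : ℝ) • δ) := by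
    simpa using (hasFDerivAt_algMeasurement hp).differentiableAt.hasFDerivAt
  refine (hdiff.comp_hasDerivAt (0 : ℝ) hline).unique
    ((hasDerivAt_const (0 : ℝ) (algMeasurement G t p)).congr_of_eventuallyEq ?_)
  have hcont : Continuous fun r : ℝ => (1 + r * b) ^ 2 + (r * a) ^ 2 := by fun_prop
  filter_upwards [hcont.continuousAt.eventually_ne (by simp : (1 + 0 * b) ^ 2 + (0 * a) ^ 2 ≠ 0)]
    with r hr
  exact algMeasurement_add_smul_trivialMotion G t p ξ a b r hr

theorem finrank_ker_form_add_card {n : ℕ} {ι : Type*} [Fintype ι] {w : ι → Fin n × Fin 2 → ℝ}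
    (hw : LinearIndependent ℝ w) :
    Module.finrank ℝ (LinearMap.ker (LinearMap.pi fun i => (form (w i)).toLinearMap)) +
      Fintype.card ι = Module.finrank ℝ (Config n) := by
  have hsurj : LinearMap.range (LinearMap.pi fun i => (form (w i)).toLinearMap) = ⊤ :=
    LinearMap.range_eq_top.2 fun y => by
      obtain ⟨δ, hδ⟩ := exists_form_eq hw y
      exact ⟨δ, funext hδ⟩
  rw [← LinearMap.finrank_range_add_finrank_ker (LinearMap.pi fun i => (form (w i)).toLinearMap),
    hsurj, finrank_top, Module.finrank_fintype_fun_eq_card, add_comm]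

theorem isInfinitesimalMotion_iff_mem_ker {n : ℕ} {G : BipGraph n} {p : Config n}
    (hp : IsGeneric p) {s : Set (Fin n × Fin n × Fin n)} (hs : s ⊆ G.triples)
    (hspan : ∀ t ∈ G.triples, evalAt p ∘ grad G t ∈
      Submodule.span ℝ (Set.range fun i : s => evalAt p ∘ grad G i)) (δ : Config n) :
    IsInfinitesimalMotion G p δ ↔ δ ∈ LinearMap.ker
      (LinearMap.pi fun i : s => (form (evalAt p ∘ grad G i)).toLinearMap) := by
  rw [isInfinitesimalMotion_iff hp, LinearMap.mem_ker]
  constructor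
  · exact fun h => funext fun i => h i (hs i.2)
  · intro h t ht
    have hle : Submodule.span ℝ (Set.range fun i : s => evalAt p ∘ grad G i) ≤
        LinearMap.ker (dotProductBilin ℝ ℝ |>.flip fun a => δ a.1 a.2) := by
      rw [Submodule.span_le]
      rintro _ ⟨i, rfl⟩
      have := congrFun h i
      simpa [form_apply] using this
    simpa [form_apply] using hle (hspan t ht)

theorem IsInfinitesimallyRigid.isGenericallyInfinitesimallyRigid {n : ℕ} (hn : 2 ≤ n)
    {G : BipGraph n} {p : Config n} (hp : IsGeneric p) (h : IsInfinitesimallyRigid G p) :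
    IsGenericallyInfinitesimallyRigid G := by
  intro q hq
  obtain ⟨s, hs, hli, hspan⟩ := exists_basis_triples G p
  have : Fintype s := Fintype.ofFinite s
  have hliq : LinearIndependent ℝ fun i : s => evalAt q ∘ grad G i :=
    hq.linearIndependent_iff.2 (hp.linearIndependent_iff.1 hli)
  have hmp := isInfinitesimalMotion_iff_mem_ker hp hs hspan
  have hmq := isInfinitesimalMotion_iff_mem_ker hq hs fun t ht => hp.mem_span hq hli (hspan t ht)
  have hdp := finrank_ker_form_add_card hli
  have hdq := finrank_ker_form_add_card hliq
  set N := fun x : Config n => LinearMap.ker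
    (LinearMap.pi fun i : s => (form (evalAt x ∘ grad G i)).toLinearMap) with hN
  have hle : N p ≤ LinearMap.range (trivialMotion p) := fun δ hδ =>
    (isTrivialMotion_iff p δ).1 (h δ ((hmp δ).2 hδ))
  have hge : LinearMap.range (trivialMotion q) ≤ N q := by
    rintro _ ⟨v, rfl⟩
    exact LinearMap.mem_ker.2 (funext fun i =>
      form_grad_trivialMotion (hq.evalAt_ne_zero (den_ne_zero (G.triples_subset (hs i.2)))) v)
  have hq01 : q ⟨0, by omega⟩ ≠ q ⟨1, by omega⟩ := hq.injective.ne (by simp)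
  -- Rank-nullity gives `N p` and `N q` the same dimension. That of `N p` is at most the dimension
  -- of the parameter space `Plane × ℝ × ℝ`, which the trivial motions at `q` attain because two
  -- nodes are distinct.
  have hfin : Module.finrank ℝ (N q) ≤ Module.finrank ℝ (LinearMap.range (trivialMotion q)) := by
    rw [LinearMap.finrank_range_of_inj (trivialMotion_injective hq01)]
    have := (Submodule.finrank_mono hle).trans (LinearMap.finrank_range_le _)
    change Module.finrank ℝ (N p) + _ = _ at hdp
    change Module.finrank ℝ (N q) + _ = _ at hdq
    omega
  intro δ hδ
  rw [isTrivialMotion_iff, Submodule.eq_of_le_of_finrank_le hge hfin]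
  exact (hmq δ).1 hδ

end SARoD

theorem mainTheorem1 (n : ℕ) (hn : 3 ≤ n) (G : SARoD.BipGraph n)
    (p : SARoD.Config n) (hp : SARoD.IsGeneric p) :
    (SARoD.IsRigid G p → SARoD.IsGenericallyRigid G) ∧
    (SARoD.IsInfinitesimallyRigid G p → SARoD.IsGenericallyInfinitesimallyRigid G) :=
  ⟨fun h => h.isGenericallyRigid hp,
    fun h => h.isGenericallyInfinitesimallyRigid (by omega) hp⟩
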